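/- For a finite tree $T$ let $W(T)$ be the set of its pendent vertices (vertices of degree $1$), let $RD(T)=(d_T(u,v))_{u,v\in W(T)}$ be its terminal distance matrix, let $TWI(T)=\frac12\sum_{u,v\in W(T)}d_T(u,v)$ be its terminal Wiener index, and let $TDSR(T)$ be the terminal distance spectral radius, i.e. the largest eigenvalue of the real symmetric matrix $RD(T)$. The degree sequence of $T$ is the sequence of all its vertex degrees in ascending order. Let $N\ge 2$ and let $\mathbf d=(d_1\le\dots\le d_N)$ be the degree sequence of at least one tree. Let $\mathcal T(\mathbf d)$ be the (finite) set of all trees with degree sequence $\mathbf d$ on the vertex set $\{0,\dots,N-1\}$, and let $n$ be the number of entries of $\mathbf d$ equal to $1$, i.e. the number of pendent vertices of every tree in $\mathcal T(\mathbf d)$. The BFS-tree (greedy tree) $BFS(\mathbf d)$ has vertices $0,1,\dots,N-1$, where vertex $i$ is assigned the degree $d_{N-i}$; vertex $0$ is the root, its children are $1,\dots,d_N$, and then, for $i=1,2,\dots$ in turn, the next $d_{N-i}-1$ vertices that are not yet attached become the children of vertex $i$ (so the levels are filled one after another, from left to right, always using the largest unused degree). Then: 1. $BFS(\mathbf d)\in\mathcal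 T(\mathbf d)$, and $\frac2n\,TWI(BFS(\mathbf d))$ is the average row sum of $RD(BFS(\mathbf d))$. 2. The minimum of $TDSR$ over $\mathcal T(\mathbf d)$ is attained, and every tree $T^{**}\in\mathcal T(\mathbf d)$ attaining it satisfies $$\frac{2}{n}\,TWI(BFS(\mathbf d))\;\le\; TDSR(T^{**})\;\le\; TDSR(BFS(\mathbf d)).$$ -/

import Mathlib

/-- The set of pendent vertices of a finite graph, i.e. the vertices of degree one. -/
noncomputable def pendent {V : Type*} [Fintype V] (G : SimpleGraph V) : Finset V :=
  open Classical in Finset.univ.filter (fun v => G.degree v = 1)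

/-- The degree sequence of a finite graph: all vertex degrees, arranged in ascending order. -/
noncomputable def degreeSequence {V : Type*} [Fintype V] (G : SimpleGraph V) : List ℕ :=
  open Classical in (Finset.univ.val.map (fun v => G.degree v)).sort (· ≤ ·)

/-- All trees with degree sequence `d`, on the standard vertex set with `d.length` elements
(every tree with degree sequence `d` is isomorphic to one of these). -/
def treesWithDegrees (d : List ℕ) : Set (SimpleGraph (Fin d.length)) :=
  {T | T.IsTree ∧ degreeSequence T = d}

/-- The terminal distance matrix: distances in `G` between pendent vertices of `G`. -/
noncomputable def terminalDistMatrix {V : Type*} [Fintype V] (G : SimpleGraph V) :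
    Matrix (pendent G) (pendent G) ℝ :=
  Matrix.of fun u v => (G.dist u.1 v.1 : ℝ)

/-- The terminal Wiener index: half of the sum of all entries of the terminal distance matrix. -/
noncomputable def terminalWienerIndex {V : Type*} [Fintype V] (G : SimpleGraph V) : ℝ :=
  1 / 2 * ∑ u, ∑ v, terminalDistMatrix G u v

/-- The terminal distance spectral radius: the largest (real) eigenvalue of the terminal distance
matrix, which is a real symmetric matrix. -/
noncomputable def terminalDistSpectralRadius {V : Type*} [Fintype V] (G : SimpleGraph V) : ℝ :=
  open Classical in sSup (spectrum ℝ (terminalDistMatrix G))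

/-- The vertices of the BFS-tree are numbered `0, 1, 2, …` level by level and from left to right
inside each level. Vertex number `i` receives the `i`-th largest element (counting from zero) of the
ascending sequence `d` as its degree. All neighbours of the root `0` are its children; for every
other vertex, one neighbour is its parent and all others are its children. -/
def bfsChildCount (d : List ℕ) (i : ℕ) : ℕ :=
  if i = 0 then d.reverse.getD 0 0 else d.reverse.getD i 0 - 1

/-- The number of the leftmost child of vertex `i` in the BFS-tree: it comes right after the root
and the children of all the vertices that precede `i`. -/
def bfsFirstChild (d : List ℕ) (i : ℕ) : ℕ :=
  1 + ∑ j ∈ Finset.range i, bfsChildCount d j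

/-- The BFS-tree (greedy tree) of an ascending degree sequence `d`: vertex `i` is joined to the
`bfsChildCount d i` consecutive vertices starting from `bfsFirstChild d i`. -/
def bfsTree (d : List ℕ) : SimpleGraph (Fin d.length) :=
  SimpleGraph.fromRel fun i j =>
    bfsFirstChild d i ≤ (j : ℕ) ∧ (j : ℕ) < bfsFirstChild d i + bfsChildCount d i

/-! The Rayleigh quotient of the all-ones vector is the average row sum, so $TDSR(T)\ge\frac2n
TWI(T)$ for every tree. The upper bound is minimality tested on the BFS-tree. What remains is that
the BFS-tree minimises $TWI$ over $\mathcal T(\mathbf d)$ (`terminalWienerIndex_bfsTree_le`).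

Root a tree and let $b(v)$ be the number of pendent vertices in the branch at $v$. The edge above
$v$ separates $b(v)(n-b(v))$ pairs of pendent vertices, so $TWI=\sum_v b(v)(n-b(v))$
(`IsRootedBy.sum_dist`). With the root at a centroid, $b\le n/2$ elsewhere, where $t(n-t)$ is
increasing and concave. Hence weak majorization suffices (`sum_mul_sub_le_of_sum_le`): any $k$
non-root vertices must have total $b$ at least that of the last $k$ vertices of the BFS-tree.

This is a strong induction on $k$ (`IsRootedBy.sum_range_card_le_sum_branchCount`). If $k\le n$, the
last $k$ vertices of the BFS-tree are pendent and have $b=1$. If $k>n$, set aside $n$ of the chosen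
vertices, each with $b\ge1$, so that the other $k-n$ are not pendent. Their $b$ is the sum of $b$
over their children, and there are at least as many children as the last $k$ BFS vertices have,
since those vertices carry the $k$ smallest degrees. The BFS-tree satisfies the same recursion,
because the children of its last $k$ vertices are again last vertices. -/

/-- A graph given by a parent function `p` with root `r`; `h` is a rank that decreases strictly
towards the root. -/
structure IsRootedBy {V : Type*} (G : SimpleGraph V) (r : V) (p : V → V) (h : V → ℕ) : Prop where
  parent_root : p r = r
  rank_lt : ∀ v, v ≠ r → h (p v) < h v
  adj_iff : ∀ u v, G.Adj u v ↔ (u ≠ r ∧ p u = v) ∨ (v ≠ r ∧ p v = u)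

open scoped Classical in
/-- The indicator of `u` lying in the branch at `v`, for a parent function `p`. -/
noncomputable def inBranch {V : Type*} (p : V → V) (v u : V) : ℤ :=
  if ∃ k, p^[k] u = v then 1 else 0

/-- The children of `v`, for a parent function `p` and a root `r`. -/
noncomputable def childrenOf {V : Type*} [Fintype V] (r : V) (p : V → V) (v : V) : Finset V :=
  open Classical in Finset.univ.filter fun c => c ≠ r ∧ p c = v

/-- The number of elements of `L` in the branch at `v`. -/
noncomputable def branchCount {V : Type*} (L : Finset V) (p : V → V) (v : V) : ℤ :=
  ∑ u ∈ L, inBranch p v u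

/-! ### Branches of a rooted tree. -/

namespace IsRootedBy

section Branch

open scoped Classical

variable {V : Type*} {G : SimpleGraph V} {r : V} {p : V → V} {h : V → ℕ}

theorem inBranch_eq_zero_or_one (p : V → V) (v u : V) : inBranch p v u = 0 ∨ inBranch p v u = 1 := by
  unfold inBranch
  split_ifs <;> simp

theorem inBranch_nonneg (p : V → V) (v u : V) : 0 ≤ inBranch p v u := by
  rcases inBranch_eq_zero_or_one p v u with h | h <;> simp [h]

theorem inBranch_self (p : V → V) (v : V) : inBranch p v v = 1 :=
  if_pos ⟨0, rfl⟩

theorem rank_parent_le (H : IsRootedBy G r p h) (v : V) : h (p v) ≤ h v := by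
  by_cases hv : v = r
  · rw [hv, H.parent_root]
  · exact (H.rank_lt v hv).le

theorem rank_iterate_le (H : IsRootedBy G r p h) (v : V) (k : ℕ) : h (p^[k] v) ≤ h v := by
  induction k with
  | zero => exact le_rfl
  | succ k ih => rw [Function.iterate_succ_apply']; exact (H.rank_parent_le _).trans ih

theorem inBranch_eq_zero_of_rank_lt (H : IsRootedBy G r p h) {v u : V} (hvu : h u < h v) :
    inBranch p v u = 0 := by
  refine if_neg ?_
  rintro ⟨k, rfl⟩
  exact absurd (H.rank_iterate_le u k) (by omega)

theorem inBranch_parent_self (H : IsRootedBy G r p h) {u : V} (hu : u ≠ r) :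
    inBranch p u (p u) = 0 :=
  H.inBranch_eq_zero_of_rank_lt (H.rank_lt u hu)

theorem inBranch_of_ne {u v : V} (huv : u ≠ v) : inBranch p v u = inBranch p v (p u) := by
  unfold inBranch
  congr 1
  apply propext
  constructor
  · rintro ⟨_ | k, hk⟩
    · exact absurd hk huv
    · exact ⟨k, hk⟩
  · rintro ⟨k, hk⟩
    exact ⟨k + 1, hk⟩

theorem inBranch_step (H : IsRootedBy G r p h) {u : V} (hu : u ≠ r) (v : V) :
    inBranch p v u = (if u = v then 1 else 0) + inBranch p v (p u) := by
  split_ifs with huv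
  · subst huv
    rw [inBranch_self, H.inBranch_parent_self hu, add_zero]
  · rw [inBranch_of_ne huv, zero_add]

theorem inBranch_root (H : IsRootedBy G r p h) (v : V) :
    inBranch p v r = if r = v then 1 else 0 := by
  unfold inBranch
  have : ∀ k, p^[k] r = r := fun k => Function.iterate_fixed H.parent_root k
  simp [this]

theorem root_inBranch (H : IsRootedBy G r p h) (u : V) : inBranch p r u = 1 := by
  induction hn : h u using Nat.strong_induction_on generalizing u with
  | _ n ih =>
    by_cases hu : u = r
    · rw [hu, inBranch_self]
    · rw [inBranch_of_ne hu, ih _ (hn ▸ H.rank_lt u hu) _ rfl]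

theorem rank_root_lt (H : IsRootedBy G r p h) {u : V} (hu : u ≠ r) : h r < h u := by
  by_contra hlt
  rcases (not_lt.mp hlt).lt_or_eq with hlt | heq
  · have := H.inBranch_eq_zero_of_rank_lt hlt
    rw [H.root_inBranch] at this
    exact one_ne_zero this
  · have h1 := H.inBranch_eq_zero_of_rank_lt (heq ▸ H.rank_lt u hu)
    rw [H.root_inBranch] at h1
    exact one_ne_zero h1

theorem inBranch_eq_zero_of_rank_le (H : IsRootedBy G r p h) {v u : V} (huv : u ≠ v)
    (hr : h u ≤ h v) : inBranch p v u = 0 := by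
  by_cases hu : u = r
  · rw [hu, H.inBranch_root, if_neg (hu ▸ huv)]
  · rw [inBranch_of_ne huv]
    exact H.inBranch_eq_zero_of_rank_lt ((H.rank_lt u hu).trans_le hr)

theorem branchCount_root (H : IsRootedBy G r p h) (L : Finset V) :
    branchCount L p r = L.card := by
  simp [branchCount, H.root_inBranch]

theorem branchCount_nonneg (L : Finset V) (p : V → V) (v : V) : 0 ≤ branchCount L p v :=
  Finset.sum_nonneg fun _ _ => inBranch_nonneg _ _ _

theorem injective_edge (H : IsRootedBy G r p h) :
    Function.Injective fun v : {v // v ≠ r} => s(v.1, p v.1) := by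
  rintro ⟨u, hu⟩ ⟨v, hv⟩ huv
  rcases Sym2.eq_iff.1 huv with ⟨h1, _⟩ | ⟨h1, h2⟩
  · exact Subtype.ext h1
  · have a := H.rank_lt u hu
    have b := H.rank_lt v hv
    dsimp only at h1 h2
    rw [h2] at a
    rw [← h1] at b
    omega

/-! ### Distance as the number of separating branches. -/

variable [Fintype V]

/-- The number of branches that contain exactly one of `u` and `v`. -/
noncomputable def separation (p : V → V) (u v : V) : ℤ :=
  ∑ w, |inBranch p w u - inBranch p w v|

theorem separation_self (p : V → V) (u : V) : separation p u u = 0 := by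
  simp [separation]

theorem separation_comm (p : V → V) (u v : V) : separation p u v = separation p v u := by
  simp only [separation, abs_sub_comm]

theorem separation_triangle (p : V → V) (u v w : V) :
    separation p u w ≤ separation p u v + separation p v w := by
  unfold separation
  rw [← Finset.sum_add_distrib]
  exact Finset.sum_le_sum fun x _ => abs_sub_le _ _ _

theorem separation_parent (H : IsRootedBy G r p h) {u : V} (hu : u ≠ r) :
    separation p u (p u) = 1 := by
  unfold separation
  rw [Finset.sum_eq_single u]
  · rw [H.inBranch_step hu]
    simp
  · intro w _ hw
    rw [H.inBranch_step hu, if_neg hw.symm]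
    simp
  · simp

theorem separation_of_adj (H : IsRootedBy G r p h) {u v : V} (huv : G.Adj u v) :
    separation p u v = 1 := by
  rcases (H.adj_iff u v).1 huv with ⟨hu, rfl⟩ | ⟨hv, rfl⟩
  · exact H.separation_parent hu
  · rw [separation_comm, H.separation_parent hv]

theorem separation_le_length (H : IsRootedBy G r p h) {u v : V} (q : G.Walk u v) :
    separation p u v ≤ q.length := by
  induction q with
  | nil => simp [separation_self]
  | cons huv q ih =>
    have := separation_triangle p _ _ _ |>.trans (add_le_add (H.separation_of_adj huv).le ih)
    simpa [add_comm] using this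

/-- Only the branch at `u` tells `u` from its parent: climbing the edge gains or loses exactly that
branch. -/
theorem separation_parent_left (H : IsRootedBy G r p h) {u : V} (hu : u ≠ r) (v : V) :
    separation p u v = separation p (p u) v + (1 - 2 * inBranch p u v) := by
  unfold separation
  have key : ∀ w, |inBranch p w u - inBranch p w v| = |inBranch p w (p u) - inBranch p w v| +
      if w = u then 1 - 2 * inBranch p u v else 0 := by
    intro w
    split_ifs with hw
    · subst hw
      rw [inBranch_self, H.inBranch_parent_self hu]
      rcases inBranch_eq_zero_or_one p w v with h1 | h1 <;> rw [h1] <;> norm_num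
    · rw [inBranch_of_ne (Ne.symm hw), add_zero]
  rw [Finset.sum_congr rfl fun w _ => key w, Finset.sum_add_distrib]
  simp

theorem exists_walk_length_eq (H : IsRootedBy G r p h) (u v : V) :
    ∃ q : G.Walk u v, (q.length : ℤ) = separation p u v := by
  induction hn : h u + h v using Nat.strong_induction_on generalizing u v with
  | _ n ih =>
    by_cases huv : u = v
    · subst huv
      exact ⟨.nil, by simp [separation_self]⟩
    -- Climb from the endpoint of larger rank: the other endpoint is then outside its branch, so the
    -- step reduces the separation by one.
    wlog hr : h v ≤ h u generalizing u v
    · obtain ⟨q, hq⟩ := this v u (by omega) (Ne.symm huv) (by omega)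
      exact ⟨q.reverse, by rw [SimpleGraph.Walk.length_reverse, hq, separation_comm]⟩
    have hu : u ≠ r := by
      rintro rfl
      exact absurd (H.rank_root_lt (Ne.symm huv)) (by omega)
    have hlt := H.rank_lt u hu
    obtain ⟨q, hq⟩ := ih _ (by omega) (p u) v rfl
    refine ⟨.cons ((H.adj_iff u (p u)).2 (Or.inl ⟨hu, rfl⟩)) q, ?_⟩
    rw [H.separation_parent_left hu, H.inBranch_eq_zero_of_rank_le (Ne.symm huv) hr, ← hq]
    simp

theorem connected (H : IsRootedBy G r p h) : G.Connected :=
  { preconnected := fun u v => (H.exists_walk_length_eq u v).choose.reachable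
    nonempty := ⟨r⟩ }

theorem dist_eq_separation (H : IsRootedBy G r p h) (u v : V) :
    (G.dist u v : ℤ) = separation p u v := by
  apply le_antisymm
  · obtain ⟨q, hq⟩ := H.exists_walk_length_eq u v
    rw [← hq]
    exact_mod_cast SimpleGraph.dist_le q
  · obtain ⟨q, hq⟩ := (H.connected.preconnected u v).exists_walk_length_eq_dist
    rw [← hq]
    exact H.separation_le_length q

theorem sum_dist (H : IsRootedBy G r p h) (L : Finset V) :
    ∑ u ∈ L, ∑ v ∈ L, (G.dist u v : ℤ) =
      2 * ∑ w, branchCount L p w * (L.card - branchCount L p w) := by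
  simp only [H.dist_eq_separation, separation]
  -- For 0/1 values $|a-b|=a+b-2ab$, which makes the sum over pairs factor into branch counts.
  have habs : ∀ w u v, |inBranch p w u - inBranch p w v| =
      inBranch p w u + inBranch p w v - 2 * (inBranch p w u * inBranch p w v) := by
    intro w u v
    rcases inBranch_eq_zero_or_one p w u with h1 | h1 <;>
      rcases inBranch_eq_zero_or_one p w v with h2 | h2 <;> rw [h1, h2] <;> norm_num
  have hcomm : ∑ u ∈ L, ∑ v ∈ L, ∑ w, |inBranch p w u - inBranch p w v| =
      ∑ w, ∑ u ∈ L, ∑ v ∈ L, |inBranch p w u - inBranch p w v| := by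
    rw [Finset.sum_comm]
    rw [Finset.sum_congr rfl fun u _ => Finset.sum_comm, Finset.sum_comm]
    exact Finset.sum_congr rfl fun w _ => Finset.sum_comm
  rw [hcomm, Finset.mul_sum]
  refine Finset.sum_congr rfl fun w _ => ?_
  simp only [habs, Finset.sum_sub_distrib, Finset.sum_add_distrib, ← Finset.mul_sum,
    ← Finset.sum_mul, Finset.sum_const, nsmul_eq_mul]
  unfold branchCount
  ring

/-! ### Children, degrees and branch counts. -/

theorem mem_childrenOf {v c : V} : c ∈ childrenOf r p v ↔ c ≠ r ∧ p c = v := by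
  simp [childrenOf]

theorem inBranch_eq_sum_children (H : IsRootedBy G r p h) (v u : V) :
    inBranch p v u = (if u = v then 1 else 0) + ∑ c ∈ childrenOf r p v, inBranch p c u := by
  induction hn : h u using Nat.strong_induction_on generalizing u with
  | _ n ih =>
    by_cases hu : u = r
    · subst hu
      rw [H.inBranch_root, Finset.sum_eq_zero, add_zero]
      intro c hc
      rw [H.inBranch_root, if_neg (mem_childrenOf.1 hc).1.symm]
    · have hc : ∀ c, inBranch p c u = (if u = c then 1 else 0) + inBranch p c (p u) :=
        H.inBranch_step hu
      rw [hc v, ih _ (hn ▸ H.rank_lt u hu) (p u) rfl, Finset.sum_congr rfl fun c _ => hc c,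
        Finset.sum_add_distrib, Finset.sum_ite_eq]
      simp [mem_childrenOf, hu]

theorem branchCount_eq_sum_children (H : IsRootedBy G r p h) (L : Finset V) (v : V) :
    branchCount L p v = (if v ∈ L then 1 else 0) + ∑ c ∈ childrenOf r p v, branchCount L p c := by
  unfold branchCount
  rw [Finset.sum_congr rfl fun u _ => H.inBranch_eq_sum_children v u, Finset.sum_add_distrib,
    Finset.sum_ite_eq', Finset.sum_comm]

theorem branchCount_le_parent (H : IsRootedBy G r p h) (L : Finset V) {v : V} (hv : v ≠ r) :
    branchCount L p v ≤ branchCount L p (p v) := by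
  rw [H.branchCount_eq_sum_children L (p v)]
  have := Finset.single_le_sum (f := branchCount L p) (s := childrenOf r p (p v))
    (fun c _ => branchCount_nonneg L p c) (mem_childrenOf.2 ⟨hv, rfl⟩)
  split_ifs <;> linarith

theorem degree_eq (H : IsRootedBy G r p h) (v : V) :
    G.degree v = (childrenOf r p v).card + if v = r then 0 else 1 := by
  have hN : G.neighborFinset v = childrenOf r p v ∪ if v = r then ∅ else {p v} := by
    ext w
    rw [SimpleGraph.mem_neighborFinset, H.adj_iff, Finset.mem_union, mem_childrenOf, or_comm]
    split_ifs with hv <;> simp [hv, eq_comm]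
  rw [← SimpleGraph.card_neighborFinset_eq_degree, hN, Finset.card_union_of_disjoint]
  · split_ifs <;> simp
  · split_ifs with hv
    · simp
    · rw [Finset.disjoint_singleton_right, mem_childrenOf]
      rintro ⟨h1, h2⟩
      have a := H.rank_lt _ h1
      have b := H.rank_lt _ hv
      rw [h2] at a
      omega

/-- Descending from `v` must end at a childless vertex, which has only its parent as neighbour. The
induction is on the gap between the rank and an upper bound `M` of all ranks. -/
theorem one_le_branchCount_pendent (H : IsRootedBy G r p h) {v : V} (hv : v ≠ r) :
    1 ≤ branchCount (pendent G) p v := by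
  obtain ⟨M, hM⟩ : ∃ M, ∀ v, h v ≤ M := ⟨∑ v, h v, fun v =>
    Finset.single_le_sum (f := h) (fun _ _ => Nat.zero_le _) (Finset.mem_univ v)⟩
  induction hn : M - h v using Nat.strong_induction_on generalizing v with
  | _ n ih =>
    rw [H.branchCount_eq_sum_children]
    have hnn : ∀ c ∈ childrenOf r p v, 0 ≤ branchCount (pendent G) p c :=
      fun c _ => branchCount_nonneg _ p c
    by_cases hl : v ∈ pendent G
    · rw [if_pos hl]
      linarith [Finset.sum_nonneg hnn]
    · rw [if_neg hl, zero_add]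
      have hdeg := H.degree_eq v
      rw [if_neg hv] at hdeg
      have hcard : (childrenOf r p v).card ≠ 0 := by
        intro h0
        rw [h0, zero_add] at hdeg
        exact hl (by simpa [pendent] using hdeg)
      obtain ⟨c, hc⟩ := Finset.card_ne_zero.1 hcard
      obtain ⟨hcr, hcv⟩ := mem_childrenOf.1 hc
      have h1 := H.rank_lt c hcr
      rw [hcv] at h1
      have h2 := hM c
      exact (ih _ (by omega) hcr rfl).trans (Finset.single_le_sum hnn hc)

theorem isTree (H : IsRootedBy G r p h) : G.IsTree := by
  rw [SimpleGraph.isTree_iff_connected_and_card]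
  refine ⟨H.connected, ?_⟩
  have hb : Function.Bijective fun v : {v // v ≠ r} =>
      (⟨s(v.1, p v.1), (H.adj_iff _ _).2 (Or.inl ⟨v.2, rfl⟩)⟩ : G.edgeSet) := by
    constructor
    · intro u v huv
      exact H.injective_edge (congrArg Subtype.val huv)
    · rintro ⟨e, he⟩
      induction e with
      | _ u v =>
        rcases (H.adj_iff u v).1 he with ⟨hu, rfl⟩ | ⟨hv, rfl⟩
        · exact ⟨⟨u, hu⟩, rfl⟩
        · exact ⟨⟨v, hv⟩, Subtype.ext Sym2.eq_swap⟩
  rw [← Nat.card_congr (Equiv.ofBijective _ hb), Nat.card_eq_fintype_card,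
    Nat.card_eq_fintype_card, Fintype.card_subtype_compl, Fintype.card_subtype_eq]
  have : 0 < Fintype.card V := Fintype.card_pos_iff.2 ⟨r⟩
  omega

/-- Stepping from the parent to `u` brings the pendent vertices of the branch nearer by one and
moves all others away by one. This is the variation that locates the centroid. -/
theorem sum_dist_parent (H : IsRootedBy G r p h) {u : V} (hu : u ≠ r) (L : Finset V) :
    ∑ l ∈ L, (G.dist u l : ℤ) =
      ∑ l ∈ L, (G.dist (p u) l : ℤ) + (L.card - 2 * branchCount L p u) := by
  simp only [H.dist_eq_separation, H.separation_parent_left hu, Finset.sum_add_distrib,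
    Finset.sum_sub_distrib, ← Finset.mul_sum, Finset.sum_const, nsmul_eq_mul, mul_one,
    branchCount]

theorem childrenOf_eq_empty_of_mem_pendent (H : IsRootedBy G r p h) {v : V} (hv : v ≠ r)
    (hl : v ∈ pendent G) : childrenOf r p v = ∅ := by
  have h1 := H.degree_eq v
  rw [(Finset.mem_filter.1 hl).2, if_neg hv] at h1
  exact Finset.card_eq_zero.1 (by omega)

end Branch

end IsRootedBy

/-! ### Rooting an arbitrary tree. -/

/-- Every tree can be rooted at every vertex. -/
theorem SimpleGraph.IsTree.exists_isRootedBy {V : Type*} [Fintype V] {G : SimpleGraph V}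
    (hG : G.IsTree) (r : V) : ∃ p, IsRootedBy G r p (G.dist r) := by
  classical
  have hpar : ∀ v, ∃ w, (v = r → w = r) ∧ (v ≠ r → G.Adj v w ∧ G.dist r w < G.dist r v) := by
    intro v
    by_cases hv : v = r
    · exact ⟨r, fun _ => rfl, fun h => absurd hv h⟩
    · obtain ⟨q, hq⟩ := (hG.connected.preconnected v r).exists_walk_length_eq_dist
      cases q with
      | nil => exact absurd rfl hv
      | cons hvw q =>
        refine ⟨_, fun h => absurd h hv, fun _ => ⟨hvw, ?_⟩⟩
        rw [SimpleGraph.dist_comm (u := r), SimpleGraph.dist_comm (u := r), ← hq,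
          SimpleGraph.Walk.length_cons]
        exact Nat.lt_succ_of_le (SimpleGraph.dist_le q)
  choose p hp using hpar
  have hlt : ∀ v, v ≠ r → G.dist r (p v) < G.dist r v := fun v hv => ((hp v).2 hv).2
  -- The parent edges are distinct and as many as the edges of a tree, so every edge is a parent
  -- edge.
  let F : {v // v ≠ r} → G.edgeSet := fun v => ⟨s(v.1, p v.1), ((hp v).2 v.2).1⟩
  have hinj : Function.Injective F := by
    rintro ⟨u, hu⟩ ⟨v, hv⟩ huv
    rcases Sym2.eq_iff.1 (congrArg Subtype.val huv) with ⟨h1, _⟩ | ⟨h1, h2⟩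
    · exact Subtype.ext h1
    · have a := hlt u hu
      have b := hlt v hv
      dsimp only at h1 h2
      rw [h2] at a
      rw [← h1] at b
      omega
  have hcard : Fintype.card {v // v ≠ r} = Fintype.card G.edgeSet := by
    have h1 := ((SimpleGraph.isTree_iff_connected_and_card).1 hG).2
    rw [Nat.card_eq_fintype_card, Nat.card_eq_fintype_card] at h1
    rw [Fintype.card_subtype_compl, Fintype.card_subtype_eq]
    omega
  have hsurj : Function.Surjective F := ((Fintype.bijective_iff_injective_and_card F).2 ⟨hinj, hcard⟩).2
  refine ⟨p, (hp r).1 rfl, hlt, fun u v => ⟨fun huv => ?_, ?_⟩⟩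
  · obtain ⟨⟨w, hw⟩, hF⟩ := hsurj ⟨s(u, v), huv⟩
    rcases Sym2.eq_iff.1 (congrArg Subtype.val hF) with ⟨h1, h2⟩ | ⟨h1, h2⟩
    · dsimp only at h1 h2
      subst h1
      exact Or.inl ⟨hw, h2⟩
    · dsimp only at h1 h2
      subst h1
      exact Or.inr ⟨hw, h2⟩
  · rintro (⟨hu, rfl⟩ | ⟨hv, rfl⟩)
    · exact ((hp u).2 hu).1
    · exact ((hp v).2 hv).1.symm

/-! ### Weak majorization and sums of smallest entries. -/

/-- A family `x` whose sums over all subsets dominate the initial sums of `y` has a larger sum of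
`t * (n - t)`, provided that all of its members lie in the range where this function increases. -/
theorem sum_mul_sub_le_of_sum_le {V : Type*} [DecidableEq V] (x : V → ℤ) (y : ℕ → ℤ) (n : ℤ)
    (S : Finset V) (hx : ∀ v ∈ S, 2 * x v ≤ n)
    (hsum : ∀ U ⊆ S, ∑ k ∈ Finset.range U.card, y k ≤ ∑ v ∈ U, x v) :
    ∑ k ∈ Finset.range S.card, y k * (n - y k) ≤ ∑ v ∈ S, x v * (n - x v) := by
  -- Strengthened for induction: the gain is at least the slope of $s(n-s)$ at any bound `t` on the
  -- values, times the excess of the sums. Adding elements in increasing order lets `t` grow.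
  suffices H : ∀ t, (∀ v ∈ S, x v ≤ t) → 2 * t ≤ n →
      (n - 2 * t) * (∑ v ∈ S, x v - ∑ k ∈ Finset.range S.card, y k) ≤
        ∑ v ∈ S, x v * (n - x v) - ∑ k ∈ Finset.range S.card, y k * (n - y k) by
    rcases S.eq_empty_or_nonempty with rfl | hS
    · simp
    · obtain ⟨v, hv, hmax⟩ := S.exists_max_image x hS
      have h1 := H (x v) hmax (hx v hv)
      have h2 := mul_nonneg (sub_nonneg.2 (hx v hv)) (sub_nonneg.2 (hsum S subset_rfl))
      linarith
  induction S using Finset.induction_on_max_value x with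
  | empty => simp
  | insert a s ha hmax ih =>
    intro t ht htn
    have hat : x a ≤ t := ht a (Finset.mem_insert_self a s)
    have h1 := ih (fun v hv => hx v (Finset.mem_insert_of_mem hv))
      (fun U hU => hsum U (hU.trans (Finset.subset_insert a s))) (x a) hmax
      (hx a (Finset.mem_insert_self a s))
    have h2 := hsum (insert a s) subset_rfl
    rw [Finset.card_insert_of_notMem ha, Finset.sum_insert ha, Finset.sum_range_succ] at h2
    rw [Finset.card_insert_of_notMem ha, Finset.sum_insert ha, Finset.sum_insert ha,
      Finset.sum_range_succ, Finset.sum_range_succ]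
    -- With $f(s)=s(n-s)$, $f(x)-f(y)-(n-2x)(x-y)=(x-y)^2$; raising the bound from `x a` to `t` only
    -- lowers the slope, and the excess is nonnegative.
    nlinarith [mul_nonneg (sub_nonneg.2 hat) (sub_nonneg.2 h2), sq_nonneg (x a - y s.card)]

theorem sum_range_card_le_sum_of_monotoneOn {N : ℕ} (a : ℕ → ℕ) (ha : MonotoneOn a (Set.Iio N))
    (S : Finset (Fin N)) : ∑ i ∈ Finset.range S.card, a i ≤ ∑ i ∈ S, a i := by
  induction S using Finset.induction_on_max with
  | empty => simp
  | insert m s hm ih =>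
    have hms : m ∉ s := fun h => lt_irrefl _ (hm m h)
    rw [Finset.card_insert_of_notMem hms, Finset.sum_insert hms, Finset.sum_range_succ, add_comm]
    refine add_le_add (ha ?_ m.2 ?_) ih
    all_goals
      have : s.card ≤ (m : ℕ) := by
        have := Finset.card_le_card (s := s) (t := Finset.Iio m) fun v hv => Finset.mem_Iio.2 (hm v hv)
        rwa [Fin.card_Iio] at this
    · exact this.trans_lt m.2
    · exact this

/-! ### Degree sequences of trees. -/

/-- The properties of the ascending degree sequence of a tree with at least two vertices. -/
structure IsTreeSequence (d : List ℕ) : Prop where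
  two_le_length : 2 ≤ d.length
  sorted : d.Pairwise (· ≤ ·)
  pos : ∀ x ∈ d, 1 ≤ x
  sum_add_two : d.sum + 2 = 2 * d.length

section Degrees

open scoped Classical

variable {V : Type*} [Fintype V]

theorem coe_degreeSequence (G : SimpleGraph V) :
    (degreeSequence G : Multiset ℕ) = Finset.univ.val.map fun v => G.degree v :=
  Multiset.sort_eq _ _

theorem count_one_degreeSequence (G : SimpleGraph V) :
    (degreeSequence G).count 1 = (pendent G).card := by
  rw [← Multiset.coe_count, coe_degreeSequence, Multiset.count_map, pendent, Finset.card_def,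
    Finset.filter_val]
  congr 1
  exact Multiset.filter_congr fun _ _ => eq_comm

theorem length_degreeSequence (G : SimpleGraph V) :
    (degreeSequence G).length = Fintype.card V := by
  rw [← Multiset.coe_card, coe_degreeSequence, Multiset.card_map]
  rfl

theorem sum_degreeSequence (G : SimpleGraph V) : (degreeSequence G).sum = ∑ v, G.degree v := by
  rw [← Multiset.sum_coe, coe_degreeSequence]
  rfl

theorem SimpleGraph.IsTree.one_le_degree {G : SimpleGraph V} (hG : G.IsTree)
    (hV : 2 ≤ Fintype.card V) (v : V) : 1 ≤ G.degree v := by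
  have : Nontrivial V := Fintype.one_lt_card_iff_nontrivial.1 hV
  obtain ⟨w, hw⟩ := exists_ne v
  obtain ⟨p, H⟩ := hG.exists_isRootedBy w
  rw [H.degree_eq, if_neg hw.symm]
  omega

theorem SimpleGraph.IsTree.sum_degree_add_two {G : SimpleGraph V} (hG : G.IsTree) :
    ∑ v, G.degree v + 2 = 2 * Fintype.card V := by
  rw [G.sum_degrees_eq_twice_card_edges, ← hG.card_edgeFinset]
  ring

theorem SimpleGraph.IsTree.isTreeSequence {G : SimpleGraph V} (hG : G.IsTree)
    (hV : 2 ≤ Fintype.card V) : IsTreeSequence (degreeSequence G) where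
  two_le_length := by rwa [length_degreeSequence]
  sorted := Multiset.pairwise_sort _ _
  pos := by
    intro x hx
    rw [← Multiset.mem_coe, coe_degreeSequence, Multiset.mem_map] at hx
    obtain ⟨v, _, rfl⟩ := hx
    exact hG.one_le_degree hV v
  sum_add_two := by rw [length_degreeSequence, sum_degreeSequence, hG.sum_degree_add_two]

theorem monotoneOn_getD {d : List ℕ} (hd : d.Pairwise (· ≤ ·)) :
    MonotoneOn (fun i => d.getD i 0) (Set.Iio d.length) := by
  intro i hi j hj hij
  have hi' : i < d.length := hi
  have hj' : j < d.length := hj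
  simp only [List.getD_eq_getElem _ _ hi', List.getD_eq_getElem _ _ hj']
  rcases hij.eq_or_lt with rfl | hlt
  · exact le_rfl
  · exact List.pairwise_iff_getElem.1 hd i j hi' hj' hlt

theorem sum_range_card_le_sum_degree {d : List ℕ} (G : SimpleGraph (Fin d.length))
    (hG : degreeSequence G = d) (U : Finset (Fin d.length)) :
    ∑ i ∈ Finset.range U.card, d.getD i 0 ≤ ∑ v ∈ U, G.degree v := by
  have hsort : d.Pairwise (· ≤ ·) := hG ▸ Multiset.pairwise_sort _ _
  set f : Fin d.length → ℕ := fun v => G.degree v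
  have hofFn : List.ofFn (f ∘ Tuple.sort f) = d := by
    refine List.Perm.eq_of_pairwise (le := (· ≤ ·)) (fun _ _ _ _ => le_antisymm) ?_ hsort ?_
    · exact List.pairwise_ofFn.2 fun i j hij => Tuple.monotone_sort f hij.le
    · rw [← Multiset.coe_eq_coe, ← Fin.univ_val_map, ← Multiset.map_map,
        Multiset.map_univ_val_equiv, ← coe_degreeSequence, hG]
  have hσ : ∀ v, G.degree v = d.getD ((Tuple.sort f).symm v) 0 := by
    intro v
    rw [List.getD_eq_getElem _ _ (Fin.is_lt _)]
    -- The list is generalised because `d` also occurs in the type of the vertices.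
    have h1 : ∀ (l : List ℕ) (hl : l = d) (i : ℕ) (hi : i < d.length), d[i] = l[i]'(hl ▸ hi) := by
      rintro l rfl i hi
      rfl
    rw [h1 _ hofFn, List.getElem_ofFn]
    exact congrArg f ((Tuple.sort f).apply_symm_apply v).symm
  have := sum_range_card_le_sum_of_monotoneOn _ (monotoneOn_getD hsort) (U.map (Tuple.sort f).symm.toEmbedding)
  rw [Finset.card_map, Finset.sum_map] at this
  refine this.trans_eq (Finset.sum_congr rfl fun v _ => ?_)
  exact (hσ v).symm

end Degrees

/-! ### Lower bound for branch counts in an arbitrary tree. -/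

namespace IsRootedBy

open scoped Classical in
/-- A sequence `y` whose initial sums satisfy the recursion of the greedy tree bounds the sums of
the numbers of pendent vertices in the branches of every tree with the same degrees. -/
theorem sum_range_card_le_sum_branchCount {V : Type*} [Fintype V] {G : SimpleGraph V} {r : V}
    {p : V → V} {h : V → ℕ} (H : IsRootedBy G r p h) (a : ℕ → ℕ) (y : ℕ → ℤ)
    (ha : ∀ U : Finset V, ∑ i ∈ Finset.range U.card, a i ≤ ∑ v ∈ U, G.degree v)
    (hsmall : ∀ k ≤ (pendent G).card, k < Fintype.card V → ∑ i ∈ Finset.range k, y i ≤ k)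
    (hlarge : ∀ k < Fintype.card V, 0 < k → ∃ k' < k,
      ∑ i ∈ Finset.range k, a i = k + k' ∧
      ∑ i ∈ Finset.range k, y i ≤ (pendent G).card + ∑ i ∈ Finset.range k', y i)
    (U : Finset V) (hU : r ∉ U) :
    ∑ i ∈ Finset.range U.card, y i ≤ ∑ v ∈ U, branchCount (pendent G) p v := by
  induction hk : U.card using Nat.strong_induction_on generalizing U with
  | _ k ih =>
    have hlt : k < Fintype.card V := by
      rw [← hk]
      exact Finset.card_lt_univ_of_notMem hU
    have hone : ∀ v ∈ U, 1 ≤ branchCount (pendent G) p v := fun v hv =>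
      H.one_le_branchCount_pendent fun h => hU (h ▸ hv)
    rcases le_or_gt k (pendent G).card with hkn | hkn
    · refine (hsmall k hkn hlt).trans ?_
      have := Finset.sum_le_sum hone
      simpa [hk] using this
    obtain ⟨W, hWU, hWcard⟩ := Finset.exists_subset_card_eq
      (s := U \ pendent G) (n := k - (pendent G).card) (by
        have := Finset.le_card_sdiff (pendent G) U
        omega)
    have hWU' : W ⊆ U := hWU.trans Finset.sdiff_subset
    have hWL : Disjoint (pendent G) W :=
      Finset.disjoint_left.2 fun v hv hw => (Finset.mem_sdiff.1 (hWU hw)).2 hv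
    obtain ⟨k', hk'k, hak, hyk⟩ := hlarge k hlt (by omega)
    have hpd : (W : Set V).PairwiseDisjoint (childrenOf r p) := by
      intro v _ w _ hvw
      refine Finset.disjoint_left.2 fun c hc hc' => hvw ?_
      rw [← (mem_childrenOf.1 hc).2, (mem_childrenOf.1 hc').2]
    have hWr : ∀ v ∈ W, v ≠ r := fun v hv h => hU (h ▸ hWU' hv)
    have hdegW : ∑ v ∈ W, G.degree v = W.card + (W.biUnion (childrenOf r p)).card := by
      rw [Finset.card_biUnion hpd, Finset.card_eq_sum_ones, ← Finset.sum_add_distrib]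
      refine Finset.sum_congr rfl fun v hv => ?_
      rw [H.degree_eq, if_neg (hWr v hv), add_comm]
    have hdegL : ∑ v ∈ pendent G, G.degree v = (pendent G).card := by
      rw [Finset.card_eq_sum_ones]
      exact Finset.sum_congr rfl fun v hv => (Finset.mem_filter.1 hv).2
    -- The set `pendent G ∪ W` has `k` elements, so its degree sum is at least the sum `k + k'` of
    -- the `k` smallest degrees; the excess over `k` counts the children of `W`.
    have hch : k' ≤ (W.biUnion (childrenOf r p)).card := by
      have h1 := ha (pendent G ∪ W)
      rw [Finset.card_union_of_disjoint hWL, Finset.sum_union hWL, hdegL, hdegW, hWcard,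
        Nat.add_sub_cancel' hkn.le, hak] at h1
      omega
    obtain ⟨C, hC, hCcard⟩ := Finset.exists_subset_card_eq hch
    have hCr : r ∉ C := by
      intro h
      obtain ⟨v, _, hv⟩ := Finset.mem_biUnion.1 (hC h)
      exact (mem_childrenOf.1 hv).1 rfl
    have h1 := ih k' hk'k C hCr hCcard
    have h2 : ∑ v ∈ C, branchCount (pendent G) p v ≤ ∑ v ∈ W, branchCount (pendent G) p v := by
      refine (Finset.sum_le_sum_of_subset_of_nonneg hC
        fun v _ _ => branchCount_nonneg _ p v).trans ?_
      rw [Finset.sum_biUnion hpd]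
      refine Finset.sum_le_sum fun v hv => ?_
      rw [H.branchCount_eq_sum_children _ v]
      split_ifs <;> linarith
    have h3 : ((pendent G).card : ℤ) ≤ ∑ v ∈ U \ W, branchCount (pendent G) p v := by
      have := Finset.sum_le_sum fun v (hv : v ∈ U \ W) => hone v (Finset.mem_sdiff.1 hv).1
      rw [Finset.sum_const, nsmul_eq_mul, mul_one, Finset.card_sdiff_of_subset hWU'] at this
      refine le_trans ?_ this
      exact_mod_cast (by omega : (pendent G).card ≤ U.card - W.card)
    rw [← Finset.sum_sdiff hWU']
    linarith

end IsRootedBy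

/-! ### The greedy tree. -/

section GreedyTree

open scoped Classical

variable {d : List ℕ}

theorem bfsFirstChild_zero (d : List ℕ) : bfsFirstChild d 0 = 1 := by
  simp [bfsFirstChild]

theorem bfsFirstChild_succ (d : List ℕ) (i : ℕ) :
    bfsFirstChild d (i + 1) = bfsFirstChild d i + bfsChildCount d i := by
  rw [bfsFirstChild, Finset.sum_range_succ, ← add_assoc, ← bfsFirstChild]

theorem bfsFirstChild_monotone (d : List ℕ) : Monotone (bfsFirstChild d) :=
  monotone_nat_of_le_succ fun i => by rw [bfsFirstChild_succ]; exact Nat.le_add_right _ _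

theorem one_le_bfsFirstChild (d : List ℕ) (i : ℕ) : 1 ≤ bfsFirstChild d i :=
  Nat.le_add_right _ _

theorem getD_reverse_eq {i : ℕ} (hi : i < d.length) :
    d.reverse.getD i 0 = d.getD (d.length - 1 - i) 0 := by
  rw [List.getD_eq_getElem _ _ (by simpa using hi), List.getD_eq_getElem _ _ (by omega),
    List.getElem_reverse]

namespace IsTreeSequence

theorem one_le_getD (hd : IsTreeSequence d) {i : ℕ} (hi : i < d.length) : 1 ≤ d.getD i 0 := by
  rw [List.getD_eq_getElem _ _ hi]
  exact hd.pos _ (List.getElem_mem hi)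

theorem one_le_getD_reverse (hd : IsTreeSequence d) {i : ℕ} (hi : i < d.length) :
    1 ≤ d.reverse.getD i 0 := by
  rw [getD_reverse_eq hi]
  exact hd.one_le_getD (by omega)

theorem getD_reverse_antitone (hd : IsTreeSequence d) {i j : ℕ} (hij : i ≤ j)
    (hj : j < d.length) : d.reverse.getD j 0 ≤ d.reverse.getD i 0 := by
  rw [getD_reverse_eq hj, getD_reverse_eq (hij.trans_lt hj)]
  exact monotoneOn_getD hd.sorted (Set.mem_Iio.2 (by omega)) (Set.mem_Iio.2 (by omega))
    (by omega)

theorem bfsFirstChild_add (hd : IsTreeSequence d) {i : ℕ} (hi : i < d.length) :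
    bfsFirstChild d (i + 1) + i = 1 + ∑ j ∈ Finset.range (i + 1), d.reverse.getD j 0 := by
  induction i with
  | zero => simp [bfsFirstChild, bfsChildCount]
  | succ i ih =>
    have h1 := hd.one_le_getD_reverse hi
    have h2 := ih (by omega)
    rw [bfsFirstChild_succ, Finset.sum_range_succ, bfsChildCount, if_neg (by omega)]
    omega

theorem bfsFirstChild_length (hd : IsTreeSequence d) : bfsFirstChild d d.length = d.length := by
  have h2 := hd.two_le_length
  have h1 := hd.bfsFirstChild_add (i := d.length - 1) (by omega)
  rw [Nat.sub_add_cancel (by omega)] at h1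
  have hsum : ∑ j ∈ Finset.range d.length, d.reverse.getD j 0 = d.sum := by
    rw [← List.sum_reverse, ← d.length_reverse, Finset.sum_range, ← List.sum_ofFn]
    congr 1
    exact List.ext_getElem (by simp) fun i h1 h2 => by simp
  have h3 := hd.sum_add_two
  omega

theorem bfsFirstChild_le_length (hd : IsTreeSequence d) {i : ℕ} (hi : i ≤ d.length) :
    bfsFirstChild d i ≤ d.length :=
  (bfsFirstChild_monotone d hi).trans_eq hd.bfsFirstChild_length

/-- Every vertex is attached before its own children are. This could fail only if an earlier vertex
had no child; then, degrees being non-increasing, all later vertices have none either and everything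
is already attached. -/
theorem lt_bfsFirstChild (hd : IsTreeSequence d) {i : ℕ} (hi : i < d.length) :
    i < bfsFirstChild d i := by
  by_cases hpos : ∀ j < i, 1 ≤ bfsChildCount d j
  · have : ∑ j ∈ Finset.range i, 1 ≤ ∑ j ∈ Finset.range i, bfsChildCount d j :=
      Finset.sum_le_sum fun j hj => hpos j (Finset.mem_range.1 hj)
    rw [Finset.sum_const, Finset.card_range, smul_eq_mul, mul_one] at this
    rw [bfsFirstChild]
    omega
  · push Not at hpos
    obtain ⟨j, hj, hj0⟩ := hpos
    have hj1 : j ≠ 0 := by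
      rintro rfl
      have := hd.one_le_getD_reverse (i := 0) (by omega)
      rw [bfsChildCount, if_pos rfl] at hj0
      omega
    have hzero : ∀ k, j ≤ k → k < d.length → bfsChildCount d k = 0 := by
      intro k hjk hk
      have := hd.getD_reverse_antitone hjk hk
      rw [bfsChildCount, if_neg hj1] at hj0
      rw [bfsChildCount, if_neg (by omega)]
      omega
    have hconst : ∀ k, i + k ≤ d.length → bfsFirstChild d (i + k) = bfsFirstChild d i := by
      intro k
      induction k with
      | zero => exact fun _ => rfl
      | succ k ih =>
        intro hk
        rw [← add_assoc, bfsFirstChild_succ, ih (by omega), hzero _ (by omega) (by omega), add_zero]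
    have := hconst (d.length - i) (by omega)
    rw [Nat.add_sub_cancel' hi.le, hd.bfsFirstChild_length] at this
    omega

theorem bfsFirstChild_length_sub_add (hd : IsTreeSequence d) {k : ℕ} (hk : k < d.length) :
    bfsFirstChild d (d.length - k) + ∑ i ∈ Finset.range k, d.getD i 0 = d.length + k := by
  induction k with
  | zero => simpa using hd.bfsFirstChild_length
  | succ k ih =>
    have h1 := ih (by omega)
    have h2 := hd.one_le_getD (i := k) (by omega)
    rw [show d.length - k = d.length - (k + 1) + 1 by omega, bfsFirstChild_succ, bfsChildCount,
      if_neg (by omega), getD_reverse_eq (by omega),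
      show d.length - 1 - (d.length - (k + 1)) = k by omega] at h1
    rw [Finset.sum_range_succ]
    omega

end IsTreeSequence

/-- The parent of vertex `c` in the greedy tree. -/
def bfsParent (d : List ℕ) (c : Fin d.length) : Fin d.length :=
  ⟨Nat.findGreatest (fun i => bfsFirstChild d i ≤ c) c, (Nat.findGreatest_le _).trans_lt c.2⟩

namespace IsTreeSequence

/-- A Galois connection between `bfsParent` and `bfsFirstChild`: parents are monotone in the
numbering, so children of a final segment form a final segment. -/
theorem le_bfsParent_iff (hd : IsTreeSequence d) {c : Fin d.length} (hc : 1 ≤ (c : ℕ)) {j : ℕ} :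
    j ≤ (bfsParent d c : ℕ) ↔ bfsFirstChild d j ≤ c := by
  constructor
  · intro hj
    refine (bfsFirstChild_monotone d hj).trans ?_
    refine Nat.findGreatest_spec (P := fun i => bfsFirstChild d i ≤ c) (Nat.zero_le _) ?_
    rwa [bfsFirstChild_zero]
  · intro hj
    refine Nat.le_findGreatest ?_ hj
    by_contra hlt
    have h1 := hd.lt_bfsFirstChild c.2
    have h2 := bfsFirstChild_monotone d (not_le.1 hlt).le
    omega

theorem bfsParent_eq_iff (hd : IsTreeSequence d) {c i : Fin d.length} (hc : 1 ≤ (c : ℕ)) :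
    bfsParent d c = i ↔ bfsFirstChild d i ≤ c ∧ (c : ℕ) < bfsFirstChild d (i + 1) := by
  rw [← hd.le_bfsParent_iff hc, ← not_le, ← hd.le_bfsParent_iff hc, Fin.ext_iff]
  omega

theorem length_pos (hd : IsTreeSequence d) : 0 < d.length := by
  have := hd.two_le_length
  omega

theorem isRootedBy_bfsTree (hd : IsTreeSequence d) :
    IsRootedBy (bfsTree d) ⟨0, hd.length_pos⟩ (bfsParent d) Fin.val := by
  have hne : ∀ v : Fin d.length, v ≠ ⟨0, hd.length_pos⟩ ↔ 1 ≤ (v : ℕ) := fun v => by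
    rw [ne_eq, Fin.ext_iff]
    exact Nat.one_le_iff_ne_zero.symm
  have hlt : ∀ v : Fin d.length, 1 ≤ (v : ℕ) → (bfsParent d v : ℕ) < v := fun v hv => by
    rw [← not_le, hd.le_bfsParent_iff hv, not_le]
    exact hd.lt_bfsFirstChild v.2
  have hrel : ∀ u v : Fin d.length, (bfsFirstChild d u ≤ v ∧
      (v : ℕ) < bfsFirstChild d u + bfsChildCount d u) ↔ 1 ≤ (v : ℕ) ∧ bfsParent d v = u := by
    intro u v
    rw [← bfsFirstChild_succ]
    constructor
    · intro h
      have hv := (one_le_bfsFirstChild d u).trans h.1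
      exact ⟨hv, (hd.bfsParent_eq_iff hv).2 h⟩
    · exact fun h => (hd.bfsParent_eq_iff h.1).1 h.2
  -- For vertex 0 the search of `Nat.findGreatest` has bound 0 and returns 0, so the root is its own
  -- parent.
  refine ⟨Fin.ext (by simp [bfsParent]),
    fun v hv => hlt v ((hne v).1 hv), fun u v => ?_⟩
  rw [bfsTree, SimpleGraph.fromRel_adj, hrel, hrel, hne, hne, or_comm, and_iff_right_of_imp]
  rintro h rfl
  rw [or_self] at h
  have := hlt u h.1
  rw [h.2] at this
  exact lt_irrefl _ this

theorem degree_bfsTree (hd : IsTreeSequence d) (i : Fin d.length) :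
    (bfsTree d).degree i = d.reverse.getD i 0 := by
  rw [hd.isRootedBy_bfsTree.degree_eq]
  have hcard : (childrenOf ⟨0, hd.length_pos⟩ (bfsParent d) i).card = bfsChildCount d i := by
    rw [← Finset.card_map Fin.valEmbedding]
    have : (childrenOf ⟨0, hd.length_pos⟩ (bfsParent d) i).map Fin.valEmbedding =
        Finset.Ico (bfsFirstChild d i) (bfsFirstChild d (i + 1)) := by
      ext c
      simp only [Finset.mem_map, IsRootedBy.mem_childrenOf, Finset.mem_Ico, Fin.valEmbedding_apply]
      constructor
      · rintro ⟨c, ⟨hc, hci⟩, rfl⟩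
        refine (hd.bfsParent_eq_iff ?_).1 hci
        rw [ne_eq, Fin.ext_iff] at hc
        exact Nat.one_le_iff_ne_zero.2 hc
      · intro hc
        have h1 := (one_le_bfsFirstChild d i).trans hc.1
        have h2 := hc.2.trans_le (hd.bfsFirstChild_le_length i.2)
        refine ⟨⟨c, h2⟩, ⟨?_, (hd.bfsParent_eq_iff h1).2 hc⟩, rfl⟩
        rw [ne_eq, Fin.ext_iff]
        exact Nat.one_le_iff_ne_zero.1 h1
    rw [this, Nat.card_Ico, bfsFirstChild_succ, Nat.add_sub_cancel_left]
  rw [hcard, bfsChildCount]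
  have := hd.one_le_getD_reverse i.2
  by_cases hi : (i : ℕ) = 0
  · simp [Fin.ext_iff, hi]
  · simp only [Fin.ext_iff, hi, if_false]
    omega

theorem degreeSequence_bfsTree (hd : IsTreeSequence d) : degreeSequence (bfsTree d) = d := by
  refine List.Perm.eq_of_pairwise (le := (· ≤ ·)) (fun _ _ _ _ => le_antisymm)
    (Multiset.pairwise_sort _ _) hd.sorted ?_
  refine List.Perm.trans ?_ d.reverse_perm
  rw [← Multiset.coe_eq_coe, coe_degreeSequence, Fin.univ_val_map]
  congr 1
  refine List.ext_getElem (by simp) fun i h1 h2 => ?_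
  rw [List.getElem_ofFn, hd.degree_bfsTree, List.getD_eq_getElem _ _ h2]

theorem bfsTree_mem (hd : IsTreeSequence d) : bfsTree d ∈ treesWithDegrees d :=
  ⟨hd.isRootedBy_bfsTree.isTree, hd.degreeSequence_bfsTree⟩

/-- The number of pendent vertices in the branch of the greedy tree at the `i`-th vertex from the
end. -/
noncomputable def bfsBranch (hd : IsTreeSequence d) (i : ℕ) : ℤ :=
  branchCount (pendent (bfsTree d)) (bfsParent d)
    ⟨d.length - 1 - i, by have := hd.length_pos; omega⟩

/-- The function `g` is the identity for the majorization and $t(n-t)$ for the Wiener index. -/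
theorem sum_bfsBranch (hd : IsTreeSequence d) (g : ℤ → ℤ) {k : ℕ} (hk : k ≤ d.length) :
    ∑ i ∈ Finset.range k, g (hd.bfsBranch i) = ∑ v ∈ Finset.univ.filter (fun v : Fin d.length => d.length ≤ (v : ℕ) + k),
      g (branchCount (pendent (bfsTree d)) (bfsParent d) v) := by
  refine Finset.sum_nbij' (fun i => ⟨d.length - 1 - i, by have := hd.length_pos; omega⟩)
    (fun v => d.length - 1 - v) ?_ ?_ ?_ ?_ ?_
  · intro i hi
    have := Finset.mem_range.1 hi
    simp only [Finset.mem_filter, Finset.mem_univ, true_and]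
    omega
  · intro v hv
    have := (Finset.mem_filter.1 hv).2
    have := v.2
    rw [Finset.mem_range]
    omega
  · intro i hi
    have := Finset.mem_range.1 hi
    simp only
    omega
  · intro v _
    have := v.2
    ext
    simp only
    omega
  · exact fun i _ => rfl

theorem getD_eq_one (hd : IsTreeSequence d) {i : ℕ} (hi : i < d.count 1) : d.getD i 0 = 1 := by
  have hil : i < d.length := hi.trans_le List.count_le_length
  by_contra hne
  have h2 := hd.one_le_getD hil
  have hdrop : (d.drop i).count 1 = 0 := by
    refine List.count_eq_zero.2 fun hmem => ?_
    obtain ⟨j, hj, hj1⟩ := List.mem_iff_getElem.1 hmem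
    rw [List.length_drop] at hj
    rw [List.getElem_drop] at hj1
    have h3 := monotoneOn_getD hd.sorted (Set.mem_Iio.2 hil)
      (Set.mem_Iio.2 (show i + j < d.length by omega)) (by omega)
    simp only [List.getD_eq_getElem _ _ (show i + j < d.length by omega), hj1] at h3
    omega
  rw [← List.take_append_drop i d, List.count_append, hdrop, add_zero] at hi
  have h4 := List.count_le_length (a := 1) (l := d.take i)
  rw [List.length_take] at h4
  omega

theorem sum_bfsBranch_le (hd : IsTreeSequence d) {k : ℕ} (hk : k < d.length)
    (hkn : k ≤ d.count 1) : ∑ i ∈ Finset.range k, hd.bfsBranch i ≤ k := by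
  have H := hd.isRootedBy_bfsTree
  suffices hle : ∀ i ∈ Finset.range k, hd.bfsBranch i ≤ 1 by
    simpa using Finset.sum_le_sum hle
  intro i hi
  have hik := Finset.mem_range.1 hi
  have hone : d.getD i 0 = 1 := 
    hd.getD_eq_one (hik.trans_le hkn)
  have hdeg := hd.degree_bfsTree ⟨d.length - 1 - i, by omega⟩
  rw [getD_reverse_eq (Fin.is_lt _), Fin.val_mk, show d.length - 1 - (d.length - 1 - i) = i by omega,
    hone, H.degree_eq, if_neg (by rw [Fin.ext_iff, Fin.val_mk, Fin.val_mk]; omega)] at hdeg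
  have hempty : childrenOf ⟨0, hd.length_pos⟩ (bfsParent d) ⟨d.length - 1 - i, by omega⟩ = ∅ :=
    Finset.card_eq_zero.1 (by omega)
  rw [bfsBranch, H.branchCount_eq_sum_children, hempty, Finset.sum_empty]
  split_ifs <;> simp

theorem sum_bfsBranch_recursion (hd : IsTreeSequence d) {k : ℕ} (hk : k < d.length) (hk0 : 0 < k) :
    ∃ k' < k, ∑ i ∈ Finset.range k, d.getD i 0 = k + k' ∧ ∑ i ∈ Finset.range k, hd.bfsBranch i ≤
      (pendent (bfsTree d)).card + ∑ i ∈ Finset.range k', hd.bfsBranch i := by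
  have H := hd.isRootedBy_bfsTree
  have h1 := hd.bfsFirstChild_length_sub_add hk
  have h2 := hd.lt_bfsFirstChild (i := d.length - k) (by omega)
  have h3 := hd.bfsFirstChild_le_length (i := d.length - k) (by omega)
  -- The number of vertices whose parent is among the last `k`.
  refine ⟨d.length - bfsFirstChild d (d.length - k), by omega, by omega, ?_⟩
  have e1 := hd.sum_bfsBranch id hk.le
  have e2 := hd.sum_bfsBranch id (k := d.length - bfsFirstChild d (d.length - k)) (by omega)
  simp only [id] at e1 e2
  rw [e1, e2]
  rw [Finset.sum_congr rfl fun v _ => H.branchCount_eq_sum_children _ v, Finset.sum_add_distrib]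
  refine add_le_add ?_ ?_
  · refine (Finset.sum_le_sum_of_subset_of_nonneg (Finset.subset_univ _) fun v _ _ => ?_).trans ?_
    · split_ifs <;> simp
    · simp
  · rw [← Finset.sum_biUnion]
    · refine Finset.sum_le_sum_of_subset_of_nonneg ?_
        fun v _ _ => IsRootedBy.branchCount_nonneg _ _ v
      intro c hc
      obtain ⟨v, hv, hcv⟩ := Finset.mem_biUnion.1 hc
      obtain ⟨hc0, rfl⟩ := IsRootedBy.mem_childrenOf.1 hcv
      have hv' := (Finset.mem_filter.1 hv).2
      have hc1 : 1 ≤ (c : ℕ) := Nat.one_le_iff_ne_zero.2 fun h => hc0 (Fin.ext h)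
      have := (hd.le_bfsParent_iff (c := c) (j := d.length - k) hc1).1 (by omega)
      rw [Finset.mem_filter]
      exact ⟨Finset.mem_univ _, by omega⟩
    · intro v _ w _ hvw
      refine Finset.disjoint_left.2 fun c hc hc' => hvw ?_
      rw [← (IsRootedBy.mem_childrenOf.1 hc).2, (IsRootedBy.mem_childrenOf.1 hc').2]

end IsTreeSequence

end GreedyTree

/-! ### The centroid and the minimality of the terminal Wiener index. -/

open scoped Classical in
/-- Every tree with at least three vertices can be rooted at a centroid with respect to its pendent
vertices. -/
theorem SimpleGraph.IsTree.exists_centroid {V : Type*} [Fintype V] {G : SimpleGraph V}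
    (hG : G.IsTree) (hV : 3 ≤ Fintype.card V) : ∃ r p h, IsRootedBy G r p h ∧
      ∀ v, v ≠ r → 2 * branchCount (pendent G) p v ≤ (pendent G).card := by
  have hne : (Finset.univ \ pendent G).Nonempty := by
    rw [Finset.sdiff_nonempty]
    intro hsub
    have h1 : ∑ v, G.degree v = ∑ _v : V, 1 :=
      Finset.sum_congr rfl fun v hv => (Finset.mem_filter.1 (hsub hv)).2
    have h2 := hG.sum_degree_add_two
    rw [h1, Finset.sum_const, Finset.card_univ, smul_eq_mul] at h2
    omega
  -- Minimise only over non-pendent vertices; a pendent child of the root has branch count 1 and is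
  -- covered by `htwo`. Deeper vertices follow because branch counts decrease away from the root.
  obtain ⟨r, hr, hmin⟩ := Finset.exists_min_image _
    (fun v => ∑ l ∈ pendent G, (G.dist v l : ℤ)) hne
  obtain ⟨p, H⟩ := hG.exists_isRootedBy r
  have htwo : 2 ≤ (pendent G).card := by
    have h1 := hG.one_le_degree (by omega) r
    have h2 : G.degree r ≠ 1 := fun h => (Finset.mem_sdiff.1 hr).2 (by simpa [pendent] using h)
    have h3 := H.degree_eq r
    rw [if_pos rfl, add_zero] at h3
    have h4 := H.branchCount_eq_sum_children (pendent G) r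
    rw [H.branchCount_root, if_neg (Finset.mem_sdiff.1 hr).2, zero_add] at h4
    have h5 := Finset.sum_le_sum fun c (hc : c ∈ childrenOf r p r) =>
      H.one_le_branchCount_pendent (IsRootedBy.mem_childrenOf.1 hc).1
    rw [← h4, Finset.sum_const, nsmul_eq_mul, mul_one] at h5
    have h6 : (childrenOf r p r).card ≤ (pendent G).card := by exact_mod_cast h5
    omega
  refine ⟨r, p, G.dist r, H, fun v hv => ?_⟩
  induction hn : G.dist r v using Nat.strong_induction_on generalizing v with
  | _ n ih =>
    by_cases hpv : p v = r
    · by_cases hl : v ∈ pendent G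
      · rw [H.branchCount_eq_sum_children, H.childrenOf_eq_empty_of_mem_pendent hv hl, if_pos hl,
          Finset.sum_empty]
        exact_mod_cast htwo
      · have h1 := hmin v (Finset.mem_sdiff.2 ⟨Finset.mem_univ v, hl⟩)
        rw [H.sum_dist_parent hv, hpv] at h1
        linarith
    · have h1 := ih _ (hn ▸ H.rank_lt v hv) (p v) hpv rfl
      have h2 := H.branchCount_le_parent (pendent G) hv
      linarith

theorem sum_terminalDistMatrix {V : Type*} [Fintype V] (G : SimpleGraph V) :
    ∑ u, ∑ v, terminalDistMatrix G u v =
      ((∑ u ∈ pendent G, ∑ v ∈ pendent G, (G.dist u v : ℤ) : ℤ) : ℝ) := by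
  push_cast
  rw [← Finset.sum_coe_sort (pendent G)]
  refine Finset.sum_congr rfl fun u _ => ?_
  rw [← Finset.sum_coe_sort (pendent G)]
  rfl

theorem SimpleGraph.IsTree.eq_top_of_length_eq_two {N : ℕ} (hN : N = 2) {T : SimpleGraph (Fin N)}
    (hT : T.IsTree) : T = ⊤ := by
  ext u v
  rw [SimpleGraph.top_adj]
  refine ⟨fun h => h.ne, fun huv => ?_⟩
  obtain ⟨p, H⟩ := hT.exists_isRootedBy u
  have h1 := H.rank_lt v huv.symm
  have h2 : p v ≠ v := fun h => by
    rw [h] at h1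
    exact lt_irrefl _ h1
  refine (H.adj_iff u v).2 (Or.inr ⟨huv.symm, ?_⟩)
  rw [ne_eq, Fin.ext_iff] at huv h2
  rw [Fin.ext_iff]
  omega

/-- The greedy tree has the smallest terminal Wiener index of all trees with its degrees. -/
theorem terminalWienerIndex_bfsTree_le {d : List ℕ} (hd : IsTreeSequence d)
    {T : SimpleGraph (Fin d.length)} (hT : T ∈ treesWithDegrees d) :
    terminalWienerIndex (bfsTree d) ≤ terminalWienerIndex T := by
  classical
  obtain ⟨hTree, hdeg⟩ := hT
  have hB := hd.isRootedBy_bfsTree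
  -- On two vertices there is no non-pendent vertex to serve as centroid, but there is only one
  -- tree.
  rcases hd.two_le_length.eq_or_lt with h2 | h3
  · rw [hTree.eq_top_of_length_eq_two h2.symm, hB.isTree.eq_top_of_length_eq_two h2.symm]
  obtain ⟨r, p, h, H, hcent⟩ := hTree.exists_centroid (by rwa [Fintype.card_fin])
  have hcT : (pendent T).card = d.count 1 := by rw [← count_one_degreeSequence, hdeg]
  have hcB : (pendent (bfsTree d)).card = d.count 1 := by
    rw [← count_one_degreeSequence, hd.degreeSequence_bfsTree]
  have hbound := H.sum_range_card_le_sum_branchCount (fun i => d.getD i 0) hd.bfsBranch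
    (fun U => by convert sum_range_card_le_sum_degree T hdeg U)
    (fun k hk hkV => hd.sum_bfsBranch_le (by rwa [Fintype.card_fin] at hkV) (hcT ▸ hk))
    (fun k hkV hk0 => by
      rw [hcT, ← hcB]
      exact hd.sum_bfsBranch_recursion (by rwa [Fintype.card_fin] at hkV) hk0)
  have key := sum_mul_sub_le_of_sum_le (branchCount (pendent T) p) hd.bfsBranch (pendent T).card
    (Finset.univ.erase r) (fun v hv => hcent v (Finset.ne_of_mem_erase hv))
    (fun U hU => hbound U fun hr => Finset.notMem_erase r _ (hU hr))
  -- The last index is the root of the greedy tree. Both roots have branch count $n$, so their terms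
  -- $t(n-t)$ vanish and they can be left out of the comparison.
  have hlast : hd.bfsBranch (d.length - 1) = (pendent T).card := by
    rw [hcT, ← hcB, ← hB.branchCount_root (pendent (bfsTree d)), IsTreeSequence.bfsBranch]
    congr 1
    exact Fin.ext (Nat.sub_self _)
  have hBsum := hd.sum_bfsBranch (fun t => t * ((pendent T).card - t)) le_rfl
  have hrange : ∀ g : ℕ → ℤ, ∑ i ∈ Finset.range d.length, g i =
      ∑ i ∈ Finset.range (d.length - 1), g i + g (d.length - 1) := fun g => by
    rw [← Finset.sum_range_succ, Nat.sub_add_cancel hd.length_pos]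
  rw [hrange, hlast, sub_self, mul_zero, add_zero,
    Finset.filter_true_of_mem fun v _ => Nat.le_add_left _ _] at hBsum
  rw [Finset.card_erase_of_mem (Finset.mem_univ r), Finset.card_univ, Fintype.card_fin, hBsum] at key
  have hTsum := Finset.add_sum_erase Finset.univ (fun v => branchCount (pendent T) p v *
    ((pendent T).card - branchCount (pendent T) p v)) (Finset.mem_univ r)
  rw [H.branchCount_root, sub_self, mul_zero, zero_add] at hTsum
  rw [hTsum] at key
  unfold terminalWienerIndex
  rw [sum_terminalDistMatrix, sum_terminalDistMatrix, H.sum_dist, hB.sum_dist, hcB, ← hcT]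
  have : (2 * ∑ v, branchCount (pendent (bfsTree d)) (bfsParent d) v *
      ((pendent T).card - branchCount (pendent (bfsTree d)) (bfsParent d) v) : ℤ) ≤
      2 * ∑ v, branchCount (pendent T) p v * ((pendent T).card - branchCount (pendent T) p v) := by
    linarith
  gcongr

/-! ### The spectral bound and the main theorem. -/

open scoped Matrix in
/-- The average row sum of a real symmetric matrix is at most its largest eigenvalue. -/
theorem Matrix.IsHermitian.sum_le_card_mul_sSup_spectrum {m : Type*} [Fintype m] [DecidableEq m]
    {A : Matrix m m ℝ} (hA : A.IsHermitian) :
    ∑ u, ∑ v, A u v ≤ Fintype.card m * sSup (spectrum ℝ A) := by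
  set c := sSup (spectrum ℝ A)
  -- The matrix $cI-A$ has spectrum $c-\sigma(A)\ge0$; its quadratic form at the all-ones vector
  -- gives the bound.
  have hpsd : (algebraMap ℝ (Matrix m m ℝ) c - A).PosSemidef := by
    rw [Matrix.posSemidef_iff_isHermitian_and_spectrum_nonneg]
    constructor
    · refine Matrix.IsHermitian.sub ?_ hA
      rw [Algebra.algebraMap_eq_smul_one]
      simp [Matrix.IsHermitian]
    · rw [← spectrum.singleton_sub_eq]
      rintro _ ⟨_, rfl, μ, hμ, rfl⟩
      exact sub_nonneg.2 (le_csSup (Matrix.finite_real_spectrum (A := A)).bddAbove hμ)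
  have h1 := hpsd.dotProduct_mulVec_nonneg (fun _ => 1)
  have h2 : star (fun _ : m => (1 : ℝ)) ⬝ᵥ
      ((algebraMap ℝ (Matrix m m ℝ) c - A) *ᵥ fun _ => 1) =
      Fintype.card m * c - ∑ u, ∑ v, A u v := by
    rw [Matrix.sub_mulVec, dotProduct_sub, Algebra.algebraMap_eq_smul_one, Matrix.smul_mulVec,
      Matrix.one_mulVec]
    simp [dotProduct, Matrix.mulVec]
  linarith

theorem two_div_mul_terminalWienerIndex_le {V : Type*} [Fintype V] (G : SimpleGraph V)
    (hG : (pendent G).Nonempty) :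
    2 / ((pendent G).card : ℝ) * terminalWienerIndex G ≤ terminalDistSpectralRadius G := by
  classical
  have hA : (terminalDistMatrix G).IsHermitian := by
    ext u v
    simp [terminalDistMatrix, SimpleGraph.dist_comm]
  have h1 := hA.sum_le_card_mul_sSup_spectrum
  rw [Fintype.card_coe] at h1
  have h0 : (0 : ℝ) < (pendent G).card := by exact_mod_cast hG.card_pos
  unfold terminalWienerIndex terminalDistSpectralRadius
  rw [show 2 / ((pendent G).card : ℝ) * (1 / 2 * ∑ u, ∑ v, terminalDistMatrix G u v) =
    (∑ u, ∑ v, terminalDistMatrix G u v) / (pendent G).card by ring, div_le_iff₀ h0, mul_comm]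
  convert h1

theorem mainTheorem1 (d : List ℕ) (hlen : 2 ≤ d.length)
    (hd : (treesWithDegrees d).Nonempty) (n : ℕ) (hn : d.count 1 = n) :
    bfsTree d ∈ treesWithDegrees d ∧
    (2 / (n : ℝ)) * terminalWienerIndex (bfsTree d) =
      (∑ u, ∑ v, terminalDistMatrix (bfsTree d) u v) / ((pendent (bfsTree d)).card : ℝ) ∧
    (∃ T ∈ treesWithDegrees d, IsMinOn terminalDistSpectralRadius (treesWithDegrees d) T) ∧
    ∀ T ∈ treesWithDegrees d, IsMinOn terminalDistSpectralRadius (treesWithDegrees d) T →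
      (2 / (n : ℝ)) * terminalWienerIndex (bfsTree d) ≤ terminalDistSpectralRadius T ∧
      terminalDistSpectralRadius T ≤ terminalDistSpectralRadius (bfsTree d) := by
  classical
  have hseq : IsTreeSequence d := by
    obtain ⟨T, hT, hTd⟩ := hd
    have := hT.isTreeSequence (by rwa [Fintype.card_fin])
    rwa [hTd] at this
  have hcard : ∀ T ∈ treesWithDegrees d, (pendent T).card = n := fun T hT => by
    rw [← count_one_degreeSequence, hT.2, hn]
  have hmem := hseq.bfsTree_mem
  have hmin := Set.exists_min_image _ terminalDistSpectralRadius
    (Set.toFinite (treesWithDegrees d)) hd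
  refine ⟨hmem, ?_, by simpa only [isMinOn_iff] using hmin, fun T hT hTmin => ⟨?_, hTmin hmem⟩⟩
  · rw [hcard _ hmem, terminalWienerIndex]
    ring
  · have hne : (pendent T).Nonempty := by
      have : Nontrivial (Fin d.length) := Fin.nontrivial_iff_two_le.2 hlen
      obtain ⟨v, hv⟩ := hT.1.exists_vert_degree_one_of_nontrivial
      exact ⟨v, by simpa [pendent] using hv⟩
    refine le_trans ?_ (two_div_mul_terminalWienerIndex_le T hne)
    rw [hcard T hT]
    exact mul_le_mul_of_nonneg_left (terminalWienerIndex_bfsTree_le hseq hT) (by positivity)
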